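/- There is an absolute constant $c>0$ such that the following holds. Let $q$ be a prime power and let $s,r,t,m$ be positive integers with $s\le t\le m<q$ and $rt\le m$. Then there is an explicit collection of $M\ge c\,\dfrac{q^r}{rt}$ linear subspaces $H_1,\dots,H_M\subseteq\mathbb F_q^m$, each of codimension $rt$, which is a strong $(s,A)$ subspace design with $$A=\frac{\left(m-1-\frac{s-1}{2}\right)s}{r(t-s+1)},$$ that is, $\sum_{i=1}^M\dim(H_i\cap W)\le A$ for every $s$-dimensional subspace $W\le\mathbb F_q^m$. If moreover $m<\operatorname{char}\mathbb F_q$, then there is an explicit collection of $M\ge c\,\dfrac{q^r}{rt}$ linear subspaces of $\mathbb F_q^m$, each of codimension $rt$, which is a strong $(s,A)$ subspace design with $$A=\frac{(m-s)s}{r(t-s+1)}.$$ Here "explicit" means the following. Identify $\mathbb F_q^m$ with the polynomials of degree less than $m$ in $\mathbb F_q[X]$, let $\omega$ be any generator of $\mathbb F_q^*$, and for $\alpha\in\mathbb F_{q^r}$ and $u\ge 1$ put $S^{(u)}_\alpha=\{\alpha^{q^j}\omega^i: 0\le j<r,\ 0\le i<u\}$. Run once through the elements of $\mathbb F_{q^r}$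 in any order and keep $\alpha$ exactly if $|S^{(u)}_\alpha|=ru$ and $S^{(u)}_\alpha$ is disjoint from $S^{(u)}_\beta$ for every $\beta$ kept before; let $\mathcal F_u$ be the set of elements kept. The first collection consists of the subspaces $\{P: P(\alpha\omega^i)=0 \text{ for } 0\le i<t\}$ for $\alpha\in\mathcal F_t$; the second consists of the subspaces $\{P: P \text{ vanishes at } \alpha \text{ with multiplicity at least } t\}$ for $\alpha\in\mathcal F_1$. -/

import Mathlib

open Polynomial
open scoped IntermediateField

/-- A finite family `H` of subspaces of `V` is a strong `(s, A)` subspace design if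
`∑ i, dim (H i ∩ W) ≤ A` for every `s`-dimensional subspace `W`. -/
def IsStrongSubspaceDesign {ι F V : Type*} [Fintype ι] [Field F] [AddCommGroup V] [Module F V]
    (H : ι → Submodule F V) (s : ℕ) (A : ℝ) : Prop :=
  ∀ W : Submodule F V, Module.finrank F W = s →
    ((∑ i, Module.finrank F (H i ⊓ W : Submodule F V) : ℕ) : ℝ) ≤ A

/-- The identification of `F ^ m` with the polynomials of degree `< m`:
`v ↦ v 0 + v 1 * X + ⋯ + v (m - 1) * X ^ (m - 1)`. -/
noncomputable def coeffPoly {F : Type*} [Field F] {m : ℕ} (v : Fin m → F) : F[X] :=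
  ∑ j : Fin m, C (v j) * X ^ (j : ℕ)

theorem coeffPoly_zero {F : Type*} [Field F] {m : ℕ} : coeffPoly (0 : Fin m → F) = 0 := by
  simp [coeffPoly]

theorem coeffPoly_add {F : Type*} [Field F] {m : ℕ} (v w : Fin m → F) :
    coeffPoly (v + w) = coeffPoly v + coeffPoly w := by
  simp [coeffPoly, add_mul, Finset.sum_add_distrib]

theorem coeffPoly_smul {F : Type*} [Field F] {m : ℕ} (a : F) (v : Fin m → F) :
    coeffPoly (a • v) = C a * coeffPoly v := by
  simp [coeffPoly, Finset.mul_sum, mul_assoc]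

/-- The folded Reed-Solomon subspace
`{P : deg P < m, P (α * ω ^ i) = 0 for i = 0, …, t - 1}` of `F ^ m`, for `α` in an extension `K`. -/
noncomputable def foldedSubspace {F K : Type*} [Field F] [Field K] [Algebra F K] (m t : ℕ)
    (ω : Fˣ) (α : K) : Submodule F (Fin m → F) where
  carrier := {v | ∀ i < t, aeval (α * algebraMap F K ω ^ i) (coeffPoly v) = 0}
  zero_mem' := by
    intro i _
    simp [coeffPoly_zero]
  add_mem' := by
    intro v w hv hw i hi
    simp [coeffPoly_add, hv i hi, hw i hi]
  smul_mem' := by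
    intro a v hv i hi
    simp [coeffPoly_smul, hv i hi]

/-- The multiplicity code subspace `{P : deg P < m, mult (P, α) ≥ t}` of `F ^ m`, for `α` in an
extension `K`; the multiplicity is that of the root `α` of `P` regarded over `K`. -/
noncomputable def multiplicitySubspace {F K : Type*} [Field F] [Field K] [Algebra F K] (m t : ℕ)
    (α : K) : Submodule F (Fin m → F) where
  carrier := {v | (X - C α) ^ t ∣ (coeffPoly v).map (algebraMap F K)}
  zero_mem' := by
    simp [coeffPoly_zero]
  add_mem' := by
    intro v w hv hw
    simpa [coeffPoly_add] using dvd_add hv hw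
  smul_mem' := by
    intro a v hv
    simpa [coeffPoly_smul] using Dvd.dvd.mul_left hv _

/-- `S_α = {α ^ (q ^ j) * ω ^ i : 0 ≤ j < r, 0 ≤ i < t}`, where `q = |F|`. -/
def foldedOrbit {F K : Type*} [Field F] [Fintype F] [Field K] [DecidableEq K] [Algebra F K]
    (r t : ℕ) (ω : Fˣ) (α : K) : Finset K :=
  (Finset.range r ×ˢ Finset.range t).image
    fun p => α ^ (Fintype.card F ^ p.1) * algebraMap F K ω ^ p.2

/-- Run through the list once (starting from its end) and keep an element `α` exactly if
`|S_α| = r * t` and `S_α` is disjoint from `S_β` for all `β` kept before. -/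
def greedyCentres {F K : Type*} [Field F] [Fintype F] [Field K] [DecidableEq K] [Algebra F K]
    (r t : ℕ) (ω : Fˣ) : List K → List K
  | [] => []
  | α :: l =>
    if (foldedOrbit r t ω α).card = r * t ∧
        ∀ β ∈ greedyCentres r t ω l, Disjoint (foldedOrbit r t ω α) (foldedOrbit r t ω β) then
      α :: greedyCentres r t ω l
    else greedyCentres r t ω l

/-- The condition `|S_α| = r * t` already forces `F(α)` to be the whole extension of degree `r`. -/
theorem adjoin_eq_top_of_card_foldedOrbit {F K : Type*} [Field F] [Fintype F] [Field K]
    [DecidableEq K] [Algebra F K] {r t : ℕ} (hr : 0 < r) (ht : 0 < t)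
    (hK : Module.finrank F K = r) (ω : Fˣ) (α : K)
    (h : (foldedOrbit r t ω α).card = r * t) : F⟮α⟯ = ⊤ := by
  have hfd : FiniteDimensional F K := Module.finite_of_finrank_pos (by omega)
  have hinj : Set.InjOn (fun p : ℕ × ℕ => α ^ (Fintype.card F ^ p.1) * algebraMap F K ω ^ p.2)
      (Finset.range r ×ˢ Finset.range t : Finset (ℕ × ℕ)) := by
    apply Finset.card_image_iff.mp
    simpa [foldedOrbit] using h
  have hle : Module.finrank F F⟮α⟯ ≤ r := hK ▸ Submodule.finrank_le F⟮α⟯.toSubmodule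
  have hpos : 0 < Module.finrank F F⟮α⟯ := Module.finrank_pos
  rcases hle.lt_or_eq with hlt | heq
  · exfalso
    have hfin : Finite F⟮α⟯ := Module.finite_of_finite F
    have hft : Fintype F⟮α⟯ := Fintype.ofFinite _
    have h1 := FiniteField.pow_card (⟨α, IntermediateField.mem_adjoin_simple_self F α⟩ : F⟮α⟯)
    rw [Module.card_eq_pow_finrank (K := F) (V := F⟮α⟯)] at h1
    have h2 : α ^ (Fintype.card F ^ Module.finrank F F⟮α⟯) = α := congrArg Subtype.val h1
    have h3 := @hinj (Module.finrank F F⟮α⟯, 0) (by simp [hlt, ht]) (0, 0) (by simp [hr, ht])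
      (by simp [h2])
    simp only [Prod.mk.injEq] at h3
    omega
  · exact IntermediateField.eq_of_le_of_finrank_eq le_top
      (by rw [heq, IntermediateField.finrank_top', hK])

/-- The kept elements meet the three requirements on the set of centres: each generates the
extension, each `S_α` has `r * t` elements, and the sets `S_α` are pairwise disjoint. -/
theorem greedyCentres_spec {F K : Type*} [Field F] [Fintype F] [Field K] [DecidableEq K]
    [Algebra F K] {r t : ℕ} (hr : 0 < r) (ht : 0 < t) (hK : Module.finrank F K = r) (ω : Fˣ)
    (l : List K) :
    (∀ α ∈ greedyCentres r t ω l, F⟮α⟯ = ⊤ ∧ (foldedOrbit r t ω α).card = r * t) ∧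
      (greedyCentres r t ω l).Pairwise
        fun α β => Disjoint (foldedOrbit r t ω α) (foldedOrbit r t ω β) := by
  induction l with
  | nil => simp [greedyCentres]
  | cons a l ih =>
    rw [greedyCentres]
    split_ifs with h
    · refine ⟨?_, List.pairwise_cons.mpr ⟨h.2, ih.2⟩⟩
      intro α hα
      rcases List.mem_cons.mp hα with rfl | hα
      · exact ⟨adjoin_eq_top_of_card_foldedOrbit hr ht hK ω _ h.1, h.1⟩
      · exact ih.1 α hα
    · exact ih

/-- The collection of folded Reed-Solomon subspaces of `F ^ m` at the centres kept from `l`. -/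
noncomputable def foldedDesign {F K : Type*} [Field F] [Fintype F] [Field K] [DecidableEq K]
    [Algebra F K] (r t m : ℕ) (ω : Fˣ) (l : List K)
    (i : Fin (greedyCentres r t ω l).length) : Submodule F (Fin m → F) :=
  foldedSubspace m t ω ((greedyCentres r t ω l).get i)

/-- The collection of multiplicity code subspaces of `F ^ m`, with one centre from each set of `r`
distinct conjugates `{α, α ^ q, …, α ^ (q ^ (r - 1))}`; for `r = 1` the centres are all elements
of `F`. (With the parameter `t = 1` the set `S_α` is this set of conjugates, and `ω` plays no
role.) -/
noncomputable def multiplicityDesign {F K : Type*} [Field F] [Fintype F] [Field K] [DecidableEq K]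
    [Algebra F K] (r t m : ℕ) (ω : Fˣ) (l : List K)
    (i : Fin (greedyCentres r 1 ω l).length) : Submodule F (Fin m → F) :=
  multiplicitySubspace m t ((greedyCentres r 1 ω l).get i)

/-! Fix W of dimension s and choose a basis P_1, …, P_s of W with distinct degrees. The bound on the
sum of dim(H_i ∩ W) comes from counting the roots of one nonzero determinant: the folded Wronskian
det(P_i(ω^j X)) for the first design, the classical Wronskian det(P_i^(j)) for the second. Both are
nonzero because, after multiplying column j by X^j in the classical case, the top coefficient is a
Vandermonde determinant up to nonzero factors (`det_scaledPoly`, `det_derivativePoly`).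

If g divides every functional on H, then a basis of W adapted to H ∩ W shows that g^dim(H ∩ W)
divides the determinant (`pow_finrank_inf_dvd_det`). Each centre thus forces roots on its orbit. The
orbits are disjoint, so each dimension is counted r(t-s+1) times within the degree
(`mul_sum_finrank_inf_le_natDegree`). The degree is at most s(m-1) - s(s-1)/2; differentiation saves
another s(s-1)/2, which leaves s(m-s).

The codimension is rt because t conditions over K are injective on polynomials of degree less than
rt, again by counting roots, and the dimensions agree.

For the size, every element with a full orbit is related to a kept one in at most 2rt ways
(`card_filter_foldedOrbit_le`). Elements without a full orbit are zero or roots of unity of small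
order, hence at most two thirds of the field (`card_pow_le_three_mul_card_filter`). This gives c =
1/6. -/

/-! ### Coefficient vectors as polynomials -/

/-- The identification of `F ^ m` with polynomials of degree `< m`, as a linear map. -/
noncomputable def coeffPolyHom (F : Type*) [Field F] (m : ℕ) : (Fin m → F) →ₗ[F] F[X] where
  toFun := coeffPoly
  map_add' := coeffPoly_add
  map_smul' a v := by simp [coeffPoly_smul, smul_eq_C_mul]

@[simp]
theorem coeffPolyHom_apply {F : Type*} [Field F] {m : ℕ} (v : Fin m → F) :
    coeffPolyHom F m v = coeffPoly v := rfl

theorem coeff_coeffPoly {F : Type*} [Field F] {m : ℕ} (v : Fin m → F) (j : Fin m) :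
    (coeffPoly v).coeff j = v j := by
  simp [coeffPoly, finsetSum_coeff, coeff_C_mul, coeff_X_pow, Fin.val_inj]

theorem coeffPolyHom_injective (F : Type*) [Field F] (m : ℕ) :
    Function.Injective (coeffPolyHom F m) := by
  intro v w h
  ext j
  rw [← coeff_coeffPoly v, ← coeff_coeffPoly w]
  exact congrArg (fun p => p.coeff j) h

theorem degree_coeffPoly_lt {F : Type*} [Field F] {m : ℕ} (v : Fin m → F) :
    (coeffPoly v).degree < m := by
  refine (degree_sum_le _ _).trans_lt ((Finset.sup_lt_iff (WithBot.bot_lt_coe m)).2 fun j _ => ?_)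
  exact (degree_C_mul_X_pow_le _ _).trans_lt (Nat.cast_lt.2 j.2)

/-! ### Distinct degrees, and determinants of polynomials -/

/-- In the image of a finite linearly independent family, one can achieve distinct degrees by
changing the family within a given submodule. -/
theorem exists_linearIndependent_natDegree_injective {F V ι : Type*} [Field F] [AddCommGroup V]
    [Module F V] [Fintype ι] (f : V →ₗ[F] F[X]) (hf : Function.Injective f) (W : Submodule F V)
    (v : ι → V) (hv : LinearIndependent F v) (hW : ∀ i, v i ∈ W) :
    ∃ w : ι → V, LinearIndependent F w ∧ (∀ i, w i ∈ W) ∧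
      Function.Injective fun i => (f (w i)).natDegree := by
  classical
  let S : Set (ι → V) := {w | LinearIndependent F w ∧ ∀ i, w i ∈ W}
  have hS : S.Nonempty := ⟨v, hv, hW⟩
  -- A family of least total degree works: if two degrees agreed, cancelling a leading term would
  -- lower the total.
  let μ : (ι → V) → ℕ := fun w => ∑ i, (f (w i)).natDegree
  obtain ⟨w, ⟨hw, hwW⟩, hmin⟩ : ∃ w ∈ S, ∀ w' ∈ S, μ w ≤ μ w' := by
    obtain ⟨w, hw, h⟩ := exists_minimalFor_of_wellFoundedLT (· ∈ S) μ hS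
    exact ⟨w, hw, fun w' hw' => le_of_not_gt fun hlt => absurd (h hw' hlt.le) (not_le.2 hlt)⟩
  refine ⟨w, hw, hwW, ?_⟩
  intro i j hij
  by_contra hne
  simp only at hij
  have hz : ∀ (u : ι → V), LinearIndependent F u → ∀ k, f (u k) ≠ 0 := fun u hu k h =>
    hu.ne_zero k (hf (by rw [h, map_zero]))
  set a : F := (f (w i)).leadingCoeff / (f (w j)).leadingCoeff with ha
  have hlj : (f (w j)).leadingCoeff ≠ 0 := leadingCoeff_ne_zero.2 (hz w hw j)
  have hli : (f (w i)).leadingCoeff ≠ 0 := leadingCoeff_ne_zero.2 (hz w hw i)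
  have ha0 : a ≠ 0 := div_ne_zero hli hlj
  set c : ι → F := Pi.single i (-a) with hc
  have hcj : c j = 0 := by simp [hc, Ne.symm hne]
  set w' : ι → V := w + (c · • w j) with hw'
  have hind : LinearIndependent F w' := (linearIndependent_add_smul_iff hcj).2 hw
  have hmem : ∀ k, w' k ∈ W := fun k => W.add_mem (hwW k) (W.smul_mem _ (hwW j))
  have hk : ∀ k, k ≠ i → w' k = w k := fun k hk => by simp [hw', hc, hk]
  have hi : f (w' i) = f (w i) - C a * f (w j) := by
    simp [hw', hc, smul_eq_C_mul, sub_eq_add_neg]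
  have hdeg : (f (w' i)).degree < (f (w i)).degree := by
    rw [hi]
    refine degree_sub_lt_left ?_ (hz w hw i) ?_
    · rw [degree_C_mul ha0, degree_eq_natDegree (hz w hw i), degree_eq_natDegree (hz w hw j), hij]
    · rw [leadingCoeff_mul, leadingCoeff_C, ha, div_mul_cancel₀ _ hlj]
  have hlt : (f (w' i)).natDegree < (f (w i)).natDegree :=
    natDegree_lt_natDegree (hz w' hind i) hdeg
  refine absurd (hmin w' ⟨hind, hmem⟩) (not_le.2 ?_)
  refine Finset.sum_lt_sum (fun k _ => ?_) ⟨i, Finset.mem_univ _, hlt⟩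
  by_cases h : k = i
  · subst h; exact hlt.le
  · rw [hk k h]

/-- A determinant of a family of linear functionals with values in an algebra, in which the
functionals are divisible by `g` on `H`, is divisible by `g ^ dim (H ∩ W)`. -/
theorem pow_finrank_inf_dvd_det {F V R : Type*} [Field F] [AddCommGroup V] [Module F V]
    [FiniteDimensional F V] [CommRing R] [Algebra F R] {s : ℕ} (L : Fin s → V →ₗ[F] R)
    (H W : Submodule F V) (hs : Module.finrank F W = s) (v : Fin s → V) (hv : ∀ i, v i ∈ W)
    (g : R) (hg : ∀ h ∈ H, ∀ j, g ∣ L j h) :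
    g ^ Module.finrank F (H ⊓ W : Submodule F V) ∣
      (Matrix.of fun i j => L j (v i)).det := by
  classical
  let U : Submodule F W := H.comap W.subtype
  have hU : Module.finrank F U = Module.finrank F (H ⊓ W : Submodule F V) := by
    rw [← LinearMap.finrank_range_of_inj (f := W.subtype ∘ₗ U.subtype)
      (W.injective_subtype.comp U.injective_subtype), LinearMap.range_comp,
      Submodule.range_subtype, Submodule.map_comap_subtype, inf_comm]
  obtain ⟨U', hc⟩ := U.exists_isCompl
  -- A basis of W extending one of H ∩ W; its rows in H are the ones divisible by g.
  let b₀ := ((Module.finBasis F U).prod (Module.finBasis F U')).map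
    (Submodule.prodEquivOfIsCompl U U' hc)
  have hcard : Fintype.card (Fin (Module.finrank F U) ⊕ Fin (Module.finrank F U')) =
      Fintype.card (Fin s) := by
    rw [← Module.finrank_eq_card_basis b₀, hs, Fintype.card_fin]
  let e := Fintype.equivOfCardEq hcard
  let b := b₀.reindex e
  let T : Finset (Fin s) := Finset.univ.image fun k => e (Sum.inl k)
  have hT : T.card = Module.finrank F U := by
    have h : Function.Injective fun k => e (Sum.inl k) := e.injective.comp Sum.inl_injective
    rw [Finset.card_image_of_injective _ h, Finset.card_univ, Fintype.card_fin]
  have hTH : ∀ i ∈ T, (b i : V) ∈ H := by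
    intro i hi
    obtain ⟨k, -, rfl⟩ := Finset.mem_image.1 hi
    simp only [b, Module.Basis.reindex_apply, Equiv.symm_apply_apply, b₀, Module.Basis.map_apply]
    have : (Submodule.prodEquivOfIsCompl U U' hc)
        (((Module.finBasis F U).prod (Module.finBasis F U')) (Sum.inl k)) =
        (Module.finBasis F U k : W) := by simp
    rw [this]
    exact (Module.finBasis F U k).2
  have hdvd : ∀ i ∈ T, ∀ j, g ∣ L j (b i) := fun i hi j => hg _ (hTH i hi) j
  choose! M' hM' using hdvd
  have hfac : (Matrix.of fun i j => L j (b i : V)) = Matrix.of fun i j =>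
      (if i ∈ T then g else 1) * (if i ∈ T then M' i j else L j (b i : V)) := by
    ext i j
    by_cases hi : i ∈ T
    · simp [hi, hM' i hi j]
    · simp [hi]
  have hdet : g ^ T.card ∣ (Matrix.of fun i j => L j (b i : V)).det := by
    rw [hfac]
    have := Matrix.det_mul_column (fun i => if i ∈ T then g else 1)
      (Matrix.of fun i j => if i ∈ T then M' i j else L j (b i : V))
    simp only [Matrix.of_apply] at this
    rw [this, Finset.prod_ite_mem, Finset.univ_inter, Finset.prod_const]
    exact dvd_mul_right _ _
  -- The given vectors need not be a basis: expressing them in the adapted one only multiplies the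
  -- determinant by a scalar.
  have hchange : (Matrix.of fun i j => L j (v i)) =
      (Matrix.of fun i k => algebraMap F R (b.repr ⟨v i, hv i⟩ k)) *
        Matrix.of fun k j => L j (b k : V) := by
    ext i j
    have h1 : v i = ∑ k, b.repr ⟨v i, hv i⟩ k • (b k : V) := by
      have := congrArg W.subtype (b.sum_repr ⟨v i, hv i⟩)
      rw [map_sum] at this
      exact this.symm
    rw [Matrix.mul_apply]
    simp only [Matrix.of_apply]
    conv_lhs => rw [h1]
    simp [Algebra.smul_def]
  rw [hchange, Matrix.det_mul, ← hU, ← hT]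
  exact hdet.mul_left _

theorem coeff_prod_sum_of_natDegree_le {R ι : Type*} [CommRing R] (S : Finset ι) (f : ι → R[X])
    (d : ι → ℕ) (h : ∀ i ∈ S, (f i).natDegree ≤ d i) :
    (∏ i ∈ S, f i).coeff (∑ i ∈ S, d i) = ∏ i ∈ S, (f i).coeff (d i) := by
  classical
  induction S using Finset.induction_on with
  | empty => simp
  | insert a S ha ih =>
    rw [Finset.prod_insert ha, Finset.sum_insert ha, Finset.prod_insert ha,
      coeff_mul_add_eq_of_natDegree_le (h a (by simp)) ?_, ih fun i hi => h i (by simp [hi])]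
    exact (natDegree_prod_le _ _).trans (Finset.sum_le_sum fun i hi => h i (by simp [hi]))

theorem natDegree_det_le_sum {R ι : Type*} [CommRing R] [Fintype ι] [DecidableEq ι]
    (A : Matrix ι ι R[X]) (d : ι → ℕ) (h : ∀ i j, (A i j).natDegree ≤ d i) :
    A.det.natDegree ≤ ∑ i, d i := by
  rw [← Matrix.det_transpose, Matrix.det_apply]
  refine natDegree_sum_le_of_forall_le _ _ fun σ _ => ?_
  refine (natDegree_smul_le _ _).trans ((natDegree_prod_le _ _).trans ?_)
  exact Finset.sum_le_sum fun i _ => h i (σ i)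

/-- Every Leibniz term takes one entry from each row, so its coefficient at the sum of the row
bounds is the product of the entries' coefficients at those bounds. Nonvanishing of a polynomial
determinant is thereby reduced to a determinant over the coefficient ring. -/
theorem coeff_det_sum_of_natDegree_le {R ι : Type*} [CommRing R] [Fintype ι] [DecidableEq ι]
    (A : Matrix ι ι R[X]) (d : ι → ℕ) (h : ∀ i j, (A i j).natDegree ≤ d i) :
    A.det.coeff (∑ i, d i) = (Matrix.of fun i j => (A i j).coeff (d i)).det := by
  rw [← Matrix.det_transpose, Matrix.det_apply, ← Matrix.det_transpose (Matrix.of _),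
    Matrix.det_apply, finsetSum_coeff]
  refine Finset.sum_congr rfl fun σ _ => ?_
  rw [coeff_smul, Matrix.transpose]
  congr 1
  simpa using coeff_prod_sum_of_natDegree_le Finset.univ (fun i => A i (σ i)) d
    fun i _ => h i (σ i)

theorem sum_le_sum_range_of_injective {s m : ℕ} (d : Fin s → ℕ) (hd : Function.Injective d)
    (hm : ∀ i, d i < m) : ∑ i, (d i : ℤ) ≤ ∑ n ∈ Finset.range s, ((m : ℤ) - 1 - n) := by
  have h := Finset.sum_le_sum_range (s := Finset.univ.image fun i => (d i : ℤ)) (c := (m : ℤ) - 1)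
    (by
      intro x hx
      obtain ⟨i, -, rfl⟩ := Finset.mem_image.1 hx
      have := hm i
      omega)
  have hinj : Function.Injective fun i => (d i : ℤ) := Nat.cast_injective.comp hd
  rwa [Finset.sum_image hinj.injOn, Finset.card_image_of_injective _ hinj, Finset.card_univ,
    Fintype.card_fin] at h

/-- The extreme case is m-1, m-2, …, m-s. This is the source of the term (s-1)/2 in the design
parameter. -/
theorem two_mul_sum_le {s m : ℕ} (d : Fin s → ℕ) (hd : Function.Injective d)
    (hm : ∀ i, d i < m) : 2 * ((∑ i, d i : ℕ) : ℝ) ≤ s * (2 * (m - 1) - (s - 1)) := by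
  have h : ((∑ i, d i : ℕ) : ℝ) ≤ ∑ n ∈ Finset.range s, ((m : ℝ) - 1 - n) := by
    exact_mod_cast sum_le_sum_range_of_injective d hd hm
  have hg : ∀ k : ℕ, 2 * ∑ n ∈ Finset.range k, ((m : ℝ) - 1 - n) = k * (2 * (m - 1) - (k - 1)) := by
    intro k
    induction k with
    | zero => simp
    | succ k ih => rw [Finset.sum_range_succ, mul_add, ih]; push_cast; ring
  rw [← hg]
  linarith

/-! ### Counting roots of the determinant -/

/-- Weighted counting of roots of a nonzero polynomial over disjoint sets. -/
theorem sum_mul_card_le_natDegree {K ι : Type*} [Field K] [DecidableEq K] [Fintype ι] {D : K[X]}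
    (hD : D ≠ 0) (T : ι → Finset K) (hT : Pairwise fun i j => Disjoint (T i) (T j)) (n : ι → ℕ)
    (h : ∀ i, ∀ a ∈ T i, (X - C a) ^ n i ∣ D) : ∑ i, (T i).card * n i ≤ D.natDegree := by
  classical
  calc ∑ i, (T i).card * n i ≤ ∑ i, ∑ a ∈ T i, D.roots.count a := by
        refine Finset.sum_le_sum fun i _ => ?_
        rw [← smul_eq_mul]
        refine Finset.card_nsmul_le_sum _ _ _ fun a ha => ?_
        rw [count_roots]
        exact (le_rootMultiplicity_iff hD).2 (h i a ha)
    _ = ∑ a ∈ Finset.univ.biUnion T, D.roots.count a :=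
        (Finset.sum_biUnion fun i _ j _ hij => hT hij).symm
    _ ≤ Multiset.card D.roots := by
        rw [← Multiset.toFinset_sum_count_eq]
        refine Finset.sum_le_sum_of_ne_zero fun a _ ha => ?_
        rwa [Multiset.mem_toFinset, ← Multiset.count_ne_zero]
    _ ≤ D.natDegree := card_roots' D

theorem mul_sum_finrank_inf_le_natDegree {F V K : Type*} [Field F] [AddCommGroup V] [Module F V]
    [FiniteDimensional F V] [Field K] [DecidableEq K] [Algebra F K] {s M : ℕ}
    (L : Fin s → V →ₗ[F] K[X]) (H : Fin M → Submodule F V) (W : Submodule F V)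
    (hs : Module.finrank F W = s) (v : Fin s → V) (hv : ∀ i, v i ∈ W)
    (hD : (Matrix.of fun i j => L j (v i)).det ≠ 0)
    (T : Fin M → Finset K) (hT : Pairwise fun i j => Disjoint (T i) (T j)) (τ n : ℕ)
    (hτ : ∀ i, (T i).card = τ)
    (h : ∀ i, ∀ a ∈ T i, ∀ h ∈ H i, ∀ j, (X - C a) ^ n ∣ L j h) :
    τ * n * ∑ i, Module.finrank F (H i ⊓ W : Submodule F V) ≤
      (Matrix.of fun i j => L j (v i)).det.natDegree := by
  refine le_trans (le_of_eq ?_) (sum_mul_card_le_natDegree hD T hT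
    (fun i => n * Module.finrank F (H i ⊓ W : Submodule F V)) fun i a ha => ?_)
  · simp only [hτ, Finset.mul_sum, mul_assoc]
  · rw [pow_mul]
    exact pow_finrank_inf_dvd_det L (H i) W hs v hv _ (h i a ha)

theorem coeffPoly_ne_zero {F ι : Type*} [Field F] {m : ℕ} {v : ι → Fin m → F}
    (hv : LinearIndependent F v) (i : ι) : coeffPoly (v i) ≠ 0 := fun h =>
  hv.ne_zero i (coeffPolyHom_injective F m (by rw [map_zero, coeffPolyHom_apply, h]))

theorem natDegree_coeffPoly_lt {F ι : Type*} [Field F] {m : ℕ} {v : ι → Fin m → F}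
    (hv : LinearIndependent F v) (i : ι) : (coeffPoly (v i)).natDegree < m :=
  (natDegree_lt_iff_degree_lt (coeffPoly_ne_zero hv i)).2 (degree_coeffPoly_lt _)

/-! ### Folded and classical Wronskians -/

/-- The scaled polynomial `P (c * X)` of the coefficient vector of `P`. -/
noncomputable def scaledPoly (F : Type*) {K : Type*} [Field F] [Field K] [Algebra F K] (m : ℕ)
    (c : K) : (Fin m → F) →ₗ[F] K[X] :=
  (aeval (C c * X : K[X]) : F[X] →ₐ[F] K[X]).toLinearMap ∘ₗ coeffPolyHom F m

theorem scaledPoly_apply {F K : Type*} [Field F] [Field K] [Algebra F K] {m : ℕ}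
    (c : K) (v : Fin m → F) :
    scaledPoly F m c v = ((coeffPoly v).map (algebraMap F K)).comp (C c * X) := by
  change aeval (C c * X : K[X]) (coeffPoly v) = _
  rw [aeval_def, comp, eval₂_map]
  rfl

theorem eval_scaledPoly {F K : Type*} [Field F] [Field K] [Algebra F K] {m : ℕ}
    (c a : K) (v : Fin m → F) :
    (scaledPoly F m c v).eval a = aeval (c * a) (coeffPoly v) := by
  simp [scaledPoly_apply, eval_comp, eval_map_algebraMap]

/-- The `j`-th derivative of the polynomial of a coefficient vector, over an extension. -/
noncomputable def derivativePoly (F K : Type*) [Field F] [Field K] [Algebra F K] (m j : ℕ) :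
    (Fin m → F) →ₗ[F] K[X] :=
  ((derivative ^ j : Module.End K K[X]).restrictScalars F) ∘ₗ
    (mapAlgHom (Algebra.ofId F K)).toLinearMap ∘ₗ coeffPolyHom F m

theorem derivativePoly_apply {F K : Type*} [Field F] [Field K] [Algebra F K] {m : ℕ} (j : ℕ)
    (v : Fin m → F) :
    derivativePoly F K m j v = derivative^[j] ((coeffPoly v).map (algebraMap F K)) := by
  simp only [derivativePoly, LinearMap.comp_apply, LinearMap.restrictScalars_apply,
    Module.End.pow_apply]
  rfl

theorem frobeniusAlgHom_pow_apply {F K : Type*} [Field F] [Fintype F] [Field K] [Algebra F K]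
    (k : ℕ) (x : K) :
    (FiniteField.frobeniusAlgHom F K ^ k : K →ₐ[F] K) x = x ^ (Fintype.card F ^ k) := by
  induction k with
  | zero => simp
  | succ k ih => rw [pow_succ', AlgHom.mul_apply, ih, FiniteField.frobeniusAlgHom_apply,
      ← pow_mul, pow_succ]

theorem algebraMap_pow_card_pow {F K : Type*} [Field F] [Fintype F] [Field K] [Algebra F K]
    (k : ℕ) (x : F) : (algebraMap F K x) ^ (Fintype.card F ^ k) = algebraMap F K x := by
  rw [← frobeniusAlgHom_pow_apply, AlgHom.commutes]

/-- The q-power Frobenius fixes ω and the coefficients of P, so it carries the zeros at αω^i to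
zeros at their conjugates. One condition over K thus yields r roots. -/
theorem aeval_conjugate_eq_zero {F K : Type*} [Field F] [Fintype F] [Field K] [Algebra F K]
    {m t : ℕ} {ω : Fˣ} {α : K} {v : Fin m → F} (hv : v ∈ foldedSubspace m t ω α) (k : ℕ) {i : ℕ}
    (hi : i < t) :
    aeval (α ^ (Fintype.card F ^ k) * algebraMap F K ω ^ i) (coeffPoly v) = 0 := by
  have h : α ^ (Fintype.card F ^ k) * algebraMap F K ω ^ i =
      (FiniteField.frobeniusAlgHom F K ^ k : K →ₐ[F] K) (α * algebraMap F K ω ^ i) := by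
    rw [map_mul, map_pow, AlgHom.commutes, frobeniusAlgHom_pow_apply]
  rw [h, aeval_algHom_apply, hv i hi, map_zero]

theorem X_sub_C_conjugate_pow_dvd {F K : Type*} [Field F] [Fintype F] [Field K] [Algebra F K]
    {m t : ℕ} {α : K} {v : Fin m → F} (hv : v ∈ multiplicitySubspace m t α) (k : ℕ) :
    (X - C (α ^ (Fintype.card F ^ k))) ^ t ∣ (coeffPoly v).map (algebraMap F K) := by
  have hv' : (X - C α) ^ t ∣ (coeffPoly v).map (algebraMap F K) := hv
  have h := map_dvd (mapRingHom (FiniteField.frobeniusAlgHom F K ^ k : K →ₐ[F] K).toRingHom) hv'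
  rw [coe_mapRingHom, map_map, Polynomial.map_pow, Polynomial.map_sub, map_X, map_C] at h
  convert h using 3
  · congr 2
    exact (frobeniusAlgHom_pow_apply k α).symm
  · exact (AlgHom.comp_algebraMap _).symm

theorem injOn_pow_of_generator {F : Type*} [Field F] [Fintype F] {ω : Fˣ}
    (hω : ∀ x : Fˣ, x ∈ Subgroup.zpowers ω) {a b : ℕ} (ha : a + 1 < Fintype.card F)
    (hb : b + 1 < Fintype.card F) (h : (ω : F) ^ a = (ω : F) ^ b) : a = b := by
  classical
  have ho : orderOf ω = Fintype.card F - 1 := by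
    rw [orderOf_eq_card_of_forall_mem_zpowers hω, Nat.card_eq_fintype_card, Fintype.card_units]
  refine pow_injOn_Iio_orderOf (x := ω) ?_ ?_ (Units.ext (by simpa using h)) <;>
  · rw [Set.mem_Iio, ho]
    omega

theorem det_scaledPoly {F K : Type*} [Field F] [Fintype F] [Field K] [Algebra F K]
    {m s : ℕ} (hm : m < Fintype.card F) {ω : Fˣ} (hω : ∀ x : Fˣ, x ∈ Subgroup.zpowers ω)
    (v : Fin s → Fin m → F) (hv : LinearIndependent F v)
    (hd : Function.Injective fun i => (coeffPoly (v i)).natDegree) :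
    (Matrix.of fun i j : Fin s => scaledPoly F m (algebraMap F K ω ^ (j : ℕ)) (v i)).det ≠ 0 ∧
      (Matrix.of fun i j : Fin s => scaledPoly F m (algebraMap F K ω ^ (j : ℕ)) (v i)).det.natDegree
        ≤ ∑ i, (coeffPoly (v i)).natDegree := by
  set A : Matrix (Fin s) (Fin s) K[X] :=
    Matrix.of fun i j : Fin s => scaledPoly F m (algebraMap F K ω ^ (j : ℕ)) (v i) with hA
  set d : Fin s → ℕ := fun i => (coeffPoly (v i)).natDegree with hdd
  have h0 := coeffPoly_ne_zero hv
  have hlt : ∀ i, d i < m := natDegree_coeffPoly_lt hv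
  have hdeg : ∀ i j, (A i j).natDegree ≤ d i := by
    intro i j
    rw [hA, Matrix.of_apply, scaledPoly_apply]
    refine natDegree_comp_le.trans ?_
    calc _ ≤ (coeffPoly (v i)).natDegree * 1 :=
          Nat.mul_le_mul natDegree_map_le ((natDegree_C_mul_le _ _).trans natDegree_X_le)
      _ = d i := mul_one _
  refine ⟨fun hz => ?_, natDegree_det_le_sum A d hdeg⟩
  have hc := coeff_det_sum_of_natDegree_le A d hdeg
  rw [hz, coeff_zero] at hc
  -- The coefficient of X^d in P(ω^j X) is multiplied by (ω^d)^j: a Vandermonde matrix in the nodes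
  -- ω^(d_i), which are distinct because d_i < m < q.
  have hcoef : (Matrix.of fun i j => (A i j).coeff (d i)) = Matrix.of fun i j =>
      algebraMap F K (coeffPoly (v i)).leadingCoeff *
        Matrix.vandermonde (fun i => algebraMap F K ω ^ d i) i j := by
    ext i j
    simp only [hA, Matrix.of_apply, scaledPoly_apply, comp_C_mul_X_coeff, coeff_map,
      Matrix.vandermonde_apply, leadingCoeff, hdd]
    rw [← pow_mul, ← pow_mul, mul_comm (j : ℕ)]
  rw [hcoef, Matrix.det_mul_column] at hc
  refine mul_ne_zero (Finset.prod_ne_zero_iff.2 fun i _ => ?_)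
    (Matrix.det_vandermonde_ne_zero_iff.2 fun i j hij => hd ?_) hc.symm
  · exact (_root_.map_ne_zero _).2 (leadingCoeff_ne_zero.2 (h0 i))
  · simp only [← map_pow] at hij
    have hi := hlt i
    have hj := hlt j
    exact injOn_pow_of_generator hω (by omega) (by omega) ((algebraMap F K).injective hij)

theorem det_derivativePoly {F K : Type*} [Field F] [Field K] [Algebra F K]
    {m s : ℕ} (hm : m < ringChar F) (v : Fin s → Fin m → F) (hv : LinearIndependent F v)
    (hd : Function.Injective fun i => (coeffPoly (v i)).natDegree) :
    (Matrix.of fun i j : Fin s => derivativePoly F K m j (v i)).det ≠ 0 ∧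
      (Matrix.of fun i j : Fin s => derivativePoly F K m j (v i)).det.natDegree +
        ∑ j : Fin s, (j : ℕ) ≤ ∑ i, (coeffPoly (v i)).natDegree := by
  set A : Matrix (Fin s) (Fin s) K[X] :=
    Matrix.of fun i j : Fin s => derivativePoly F K m j (v i) with hA
  -- The factor X^j restores the degree lost to the j-th derivative, so all entries of row i share
  -- the bound d_i. Removing these factors later saves the sum of the j in the degree.
  set B : Matrix (Fin s) (Fin s) K[X] := Matrix.of fun i j : Fin s => X ^ (j : ℕ) * A i j with hB
  set d : Fin s → ℕ := fun i => (coeffPoly (v i)).natDegree with hdd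
  have h0 := coeffPoly_ne_zero hv
  have hlt : ∀ i, d i < m := natDegree_coeffPoly_lt hv
  have hnd : ∀ i, ((coeffPoly (v i)).map (algebraMap F K)).natDegree = d i := fun i =>
    natDegree_map _
  have hdeg : ∀ i j, (B i j).natDegree ≤ d i := by
    intro i j
    simp only [hB, hA, Matrix.of_apply, derivativePoly_apply]
    rcases le_or_gt (j : ℕ) (d i) with hj | hj
    · refine natDegree_mul_le.trans ?_
      have h1 := natDegree_iterate_derivative ((coeffPoly (v i)).map (algebraMap F K)) (j : ℕ)
      rw [hnd] at h1
      have h2 := natDegree_X_pow_le (R := K) (j : ℕ)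
      omega
    · rw [iterate_derivative_eq_zero (by rwa [hnd]), mul_zero]
      simp
  have hdet : B.det = X ^ (∑ j : Fin s, (j : ℕ)) * A.det := by
    rw [hB, Matrix.det_mul_row, Finset.prod_pow_eq_pow_sum]
  have hBne : B.det ≠ 0 := by
    intro hz
    have hc := coeff_det_sum_of_natDegree_le B d hdeg
    rw [hz, coeff_zero] at hc
    have hcoef : (Matrix.of fun i j => (B i j).coeff (d i)) = Matrix.of fun i j =>
        algebraMap F K (coeffPoly (v i)).leadingCoeff *
          Matrix.of (fun i j : Fin s => (descPochhammer K j).eval ((d i : ℕ) : K)) i j := by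
      ext i j
      simp only [hB, hA, Matrix.of_apply, derivativePoly_apply, coeff_X_pow_mul',
        coeff_iterate_derivative, descPochhammer_eval_eq_descFactorial]
      split_ifs with hj
      · rw [Nat.sub_add_cancel hj, coeff_map, nsmul_eq_mul, mul_comm]
        rfl
      · rw [Nat.descFactorial_of_lt (by omega)]
        simp
    -- Falling factorials are monic of degree j in d_i, so this determinant equals the Vandermonde
    -- determinant of the d_i. These stay distinct in K since they lie below the characteristic.
    rw [hcoef, Matrix.det_mul_column, ← Matrix.det_eval_matrixOfPolynomials_eq_det_vandermonde _ _
      (fun i => descPochhammer_natDegree K i) (fun i => monic_descPochhammer K i)] at hc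
    refine mul_ne_zero (Finset.prod_ne_zero_iff.2 fun i _ => ?_)
      (Matrix.det_vandermonde_ne_zero_iff.2 fun i j hij => hd ?_) hc.symm
    · exact (_root_.map_ne_zero _).2 (leadingCoeff_ne_zero.2 (h0 i))
    · have := charP_of_injective_algebraMap (algebraMap F K).injective (ringChar F)
      exact CharP.natCast_injOn_Iio K (ringChar F) ((hlt i).trans hm) ((hlt j).trans hm) hij
  have hAne : A.det ≠ 0 := fun h => hBne (by rw [hdet, h, mul_zero])
  refine ⟨hAne, ?_⟩
  have := natDegree_det_le_sum B d hdeg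
  rwa [hdet, natDegree_mul (pow_ne_zero _ X_ne_zero) hAne, natDegree_X_pow, add_comm] at this

/-! ### The two subspace design bounds -/

theorem exists_distinct_natDegree_of_finrank_eq {F : Type*} [Field F] {m s : ℕ}
    (W : Submodule F (Fin m → F)) (hW : Module.finrank F W = s) :
    ∃ v : Fin s → Fin m → F, LinearIndependent F v ∧ (∀ i, v i ∈ W) ∧
      Function.Injective fun i => (coeffPoly (v i)).natDegree := by
  let b := Module.finBasisOfFinrankEq F W hW
  exact exists_linearIndependent_natDegree_injective (coeffPolyHom F m)
    (coeffPolyHom_injective F m) W (fun i => (b i : Fin m → F))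
    (b.linearIndependent.map' W.subtype W.ker_subtype) fun i => (b i).2

theorem injOn_of_card_foldedOrbit {F K : Type*} [Field F] [Fintype F] [Field K] [DecidableEq K]
    [Algebra F K] {r t : ℕ} {ω : Fˣ} {α : K} (h : (foldedOrbit r t ω α).card = r * t) :
    Set.InjOn (fun p : ℕ × ℕ => α ^ (Fintype.card F ^ p.1) * algebraMap F K ω ^ p.2)
      (Finset.range r ×ˢ Finset.range t : Finset (ℕ × ℕ)) := by
  apply Finset.card_image_iff.mp
  simpa [foldedOrbit] using h

theorem foldedOrbit_mono {F K : Type*} [Field F] [Fintype F] [Field K] [DecidableEq K]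
    [Algebra F K] (r : ℕ) {t u : ℕ} (h : u ≤ t) (ω : Fˣ) (α : K) :
    foldedOrbit r u ω α ⊆ foldedOrbit r t ω α :=
  Finset.image_subset_image (Finset.product_subset_product_right (Finset.range_mono h))

theorem card_foldedOrbit_of_le {F K : Type*} [Field F] [Fintype F] [Field K] [DecidableEq K]
    [Algebra F K] {r t u : ℕ} {ω : Fˣ} {α : K} (h : (foldedOrbit r t ω α).card = r * t)
    (hu : u ≤ t) : (foldedOrbit r u ω α).card = r * u := by
  rw [foldedOrbit, Finset.card_image_of_injOn, Finset.card_product, Finset.card_range,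
    Finset.card_range]
  refine (injOn_of_card_foldedOrbit h).mono ?_
  exact_mod_cast Finset.product_subset_product_right (Finset.range_mono hu)

theorem pairwise_disjoint_foldedOrbit_get {F K : Type*} [Field F] [Fintype F] [Field K]
    [DecidableEq K] [Algebra F K] {r t : ℕ} (hr : 0 < r) (ht : 0 < t)
    (hK : Module.finrank F K = r) (ω : Fˣ) (l : List K) :
    Pairwise fun i j : Fin (greedyCentres r t ω l).length =>
      Disjoint (foldedOrbit r t ω ((greedyCentres r t ω l).get i))
        (foldedOrbit r t ω ((greedyCentres r t ω l).get j)) := by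
  have h := List.pairwise_iff_get.1 (greedyCentres_spec hr ht hK ω l).2
  intro i j hij
  rcases lt_or_gt_of_ne hij with hlt | hlt
  · exact h i j hlt
  · exact (h j i hlt).symm

theorem isStrongSubspaceDesign_foldedDesign {F K : Type*} [Field F] [Fintype F] [Field K]
    [DecidableEq K] [Algebra F K] {s r t m : ℕ} (hs : 0 < s) (hr : 0 < r) (hst : s ≤ t)
    (hm : m < Fintype.card F) (hK : Module.finrank F K = r) {ω : Fˣ}
    (hω : ∀ x : Fˣ, x ∈ Subgroup.zpowers ω) (l : List K) :
    IsStrongSubspaceDesign (foldedDesign r t m ω l) s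
      (((m : ℝ) - 1 - ((s : ℝ) - 1) / 2) * s / ((r : ℝ) * ((t : ℝ) - s + 1))) := by
  intro W hW
  have ht : 0 < t := hs.trans_le hst
  obtain ⟨v, hv, hvW, hd⟩ := exists_distinct_natDegree_of_finrank_eq W hW
  obtain ⟨hne, hdeg⟩ := det_scaledPoly (K := K) hm hω v hv hd
  have hspec := greedyCentres_spec hr ht hK ω l
  have key := (mul_sum_finrank_inf_le_natDegree
    (fun j : Fin s => scaledPoly F m (algebraMap F K ω ^ (j : ℕ))) (foldedDesign r t m ω l) W hW
    -- Only t-s+1 powers of ω are used: shifting by ω^j with j < s then stays within the t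
    -- prescribed zeros.
    v hvW hne (fun i => foldedOrbit r (t - s + 1) ω ((greedyCentres r t ω l).get i))
    (fun i j hij => (pairwise_disjoint_foldedOrbit_get hr ht hK ω l hij).mono
      (foldedOrbit_mono r (by omega) ω _) (foldedOrbit_mono r (by omega) ω _))
    (r * (t - s + 1)) 1
    (fun i => card_foldedOrbit_of_le (hspec.1 _ (List.get_mem _ i)).2 (by omega)) ?_).trans hdeg
  · have h1 := two_mul_sum_le _ hd (natDegree_coeffPoly_lt hv)
    rw [mul_one] at key
    have h2 : ((r * (t - s + 1) * ∑ i, Module.finrank F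
        (foldedDesign r t m ω l i ⊓ W : Submodule F (Fin m → F)) : ℕ) : ℝ) ≤
        ((∑ i, (coeffPoly (v i)).natDegree : ℕ) : ℝ) := by exact_mod_cast key
    rw [Nat.cast_mul, Nat.cast_mul, Nat.cast_add, Nat.cast_sub hst, Nat.cast_one] at h2
    have hpos : (0 : ℝ) < (r : ℝ) * ((t : ℝ) - s + 1) := by
      have : (s : ℝ) ≤ t := by exact_mod_cast hst
      have : (0 : ℝ) < r := by exact_mod_cast hr
      exact mul_pos this (by linarith)
    rw [le_div_iff₀ hpos]
    linarith
  · intro i a ha h hh j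
    obtain ⟨⟨k, e⟩, hp, rfl⟩ := Finset.mem_image.1 ha
    simp only [Finset.mem_product, Finset.mem_range] at hp
    have hj := j.2
    rw [pow_one, dvd_iff_isRoot, IsRoot, eval_scaledPoly, mul_left_comm, ← pow_add]
    exact aeval_conjugate_eq_zero hh k (by omega)

theorem isStrongSubspaceDesign_multiplicityDesign {F K : Type*} [Field F] [Fintype F] [Field K]
    [DecidableEq K] [Algebra F K] {s r t m : ℕ} (hr : 0 < r) (hst : s ≤ t)
    (hm : m < ringChar F) (hK : Module.finrank F K = r) (ω : Fˣ) (l : List K) :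
    IsStrongSubspaceDesign (multiplicityDesign r t m ω l) s
      (((m : ℝ) - s) * s / ((r : ℝ) * ((t : ℝ) - s + 1))) := by
  intro W hW
  obtain ⟨v, hv, hvW, hd⟩ := exists_distinct_natDegree_of_finrank_eq W hW
  obtain ⟨hne, hdeg⟩ := det_derivativePoly (K := K) hm v hv hd
  have hspec := greedyCentres_spec hr one_pos hK ω l
  have key := mul_sum_finrank_inf_le_natDegree
    (fun j : Fin s => derivativePoly F K m j) (multiplicityDesign r t m ω l) W hW
    v hvW hne (fun i => foldedOrbit r 1 ω ((greedyCentres r 1 ω l).get i))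
    (pairwise_disjoint_foldedOrbit_get hr one_pos hK ω l) (r * 1) (t - s + 1)
    (fun i => (hspec.1 _ (List.get_mem _ i)).2) ?_
  · have h1 := two_mul_sum_le _ hd (natDegree_coeffPoly_lt hv)
    have h2 : ((r * 1 * (t - s + 1) * ∑ i, Module.finrank F
        (multiplicityDesign r t m ω l i ⊓ W : Submodule F (Fin m → F)) : ℕ) : ℝ) +
        ((∑ j : Fin s, (j : ℕ) : ℕ) : ℝ) ≤
        ((∑ i, (coeffPoly (v i)).natDegree : ℕ) : ℝ) := by
      exact_mod_cast (Nat.add_le_add_right key _).trans hdeg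
    have h3 : 2 * ((∑ j : Fin s, (j : ℕ) : ℕ) : ℝ) = s * ((s : ℝ) - 1) := by
      rw [Fin.sum_univ_eq_sum_range (fun j => j), mul_comm]
      rcases s.eq_zero_or_pos with rfl | hs
      · simp
      · rw [← Nat.cast_pred hs]
        exact_mod_cast Finset.sum_range_id_mul_two s
    rw [mul_one, Nat.cast_mul, Nat.cast_mul, Nat.cast_add, Nat.cast_sub hst, Nat.cast_one] at h2
    have hpos : (0 : ℝ) < (r : ℝ) * ((t : ℝ) - s + 1) := by
      have : (s : ℝ) ≤ t := by exact_mod_cast hst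
      have : (0 : ℝ) < r := by exact_mod_cast hr
      exact mul_pos this (by linarith)
    rw [le_div_iff₀ hpos]
    linarith
  · intro i a ha h hh j
    obtain ⟨⟨k, e⟩, hp, rfl⟩ := Finset.mem_image.1 ha
    simp only [Finset.mem_product, Finset.mem_range] at hp
    have he : e = 0 := by omega
    have hj := j.2
    rw [he, pow_zero, mul_one, derivativePoly_apply]
    -- The j-th derivative keeps multiplicity t-j, which is at least t-s+1 because j < s.
    exact (pow_dvd_pow _ (by omega)).trans
      (pow_sub_dvd_iterate_derivative_of_pow_dvd j (X_sub_C_conjugate_pow_dvd hh k))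

/-! ### Codimension of the subspaces -/

theorem coeffPoly_coeff {F : Type*} [Field F] {m : ℕ} {p : F[X]} (hp : p.degree < m) :
    coeffPoly (fun j : Fin m => p.coeff j) = p := by
  ext n
  by_cases hn : n < m
  · exact coeff_coeffPoly _ ⟨n, hn⟩
  · have hmn : (m : WithBot ℕ) ≤ n := Nat.cast_le.2 (not_lt.1 hn)
    rw [coeff_eq_zero_of_degree_lt ((degree_coeffPoly_lt _).trans_le hmn),
      coeff_eq_zero_of_degree_lt (hp.trans_le hmn)]

/-- `t` linear conditions over an extension of degree `r`, independent on the polynomials of degree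
less than `r * t`, cut out a subspace of codimension `r * t`. -/
theorem finrank_quotient_ker_comp_coeffPolyHom {F K : Type*} [Field F] [Field K] [Algebra F K]
    {r t m : ℕ} (hr : 0 < r) (hK : Module.finrank F K = r) (hrt : r * t ≤ m)
    (φ : F[X] →ₗ[F] (Fin t → K)) (hφ : ∀ p : F[X], p.degree < (r * t : ℕ) → φ p = 0 → p = 0) :
    Module.finrank F ((Fin m → F) ⧸ LinearMap.ker (φ ∘ₗ coeffPolyHom F m)) = r * t := by
  have : FiniteDimensional F K := Module.finite_of_finrank_pos (by omega)
  have hdim : Module.finrank F (Fin t → K) = r * t := by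
    rw [Module.finrank_pi_fintype]
    simp [hK, mul_comm]
  have hinj : Function.Injective (φ ∘ₗ coeffPolyHom F (r * t)) := by
    rw [injective_iff_map_eq_zero]
    intro v hv
    exact coeffPolyHom_injective F _
      ((hφ _ (degree_coeffPoly_lt v) hv).trans (map_zero (coeffPolyHom F (r * t))).symm)
  -- Source and target both have dimension rt over F; padding with zeros then carries surjectivity
  -- over to `F ^ m`.
  have hsurj := (LinearMap.injective_iff_surjective_of_finrank_eq_finrank
    (by rw [hdim, Module.finrank_fin_fun])).1 hinj
  have hsurj' : Function.Surjective (φ ∘ₗ coeffPolyHom F m) := by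
    intro y
    obtain ⟨v, rfl⟩ := hsurj y
    refine ⟨fun j => (coeffPoly v).coeff j, ?_⟩
    simp only [LinearMap.comp_apply, coeffPolyHom_apply]
    rw [coeffPoly_coeff ((degree_coeffPoly_lt v).trans_le (Nat.cast_le.2 hrt))]
  rw [(LinearMap.quotKerEquivOfSurjective _ hsurj').finrank_eq, hdim]

theorem finrank_quotient_foldedSubspace {F K : Type*} [Field F] [Fintype F] [Field K]
    [DecidableEq K] [Algebra F K] {r t m : ℕ} (hr : 0 < r) (hK : Module.finrank F K = r)
    (hrt : r * t ≤ m) {ω : Fˣ} {α : K} (hα : (foldedOrbit r t ω α).card = r * t) :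
    Module.finrank F ((Fin m → F) ⧸ foldedSubspace m t ω α) = r * t := by
  let φ : F[X] →ₗ[F] (Fin t → K) :=
    LinearMap.pi fun i => (aeval (α * algebraMap F K ω ^ (i : ℕ))).toLinearMap
  have hker : ∀ n, foldedSubspace n t ω α = LinearMap.ker (φ ∘ₗ coeffPolyHom F n) := by
    intro n
    ext v
    rw [LinearMap.mem_ker, funext_iff]
    exact ⟨fun h i => h i i.2, fun h i hi => h ⟨i, hi⟩⟩
  rw [hker]
  refine finrank_quotient_ker_comp_coeffPolyHom hr hK hrt φ fun p hp h => ?_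
  by_contra hp0
  have hmem : (fun j : Fin (r * t) => p.coeff j) ∈ foldedSubspace (r * t) t ω α := by
    rw [hker, LinearMap.mem_ker, LinearMap.comp_apply, coeffPolyHom_apply, coeffPoly_coeff hp, h]
  have hne : p.map (algebraMap F K) ≠ 0 := Polynomial.map_ne_zero hp0
  -- A nonzero polynomial of degree less than rt cannot vanish on the full orbit, which has rt
  -- points.
  have hc := sum_mul_card_le_natDegree hne (fun _ : Unit => foldedOrbit r t ω α)
    (fun i j hij => (hij rfl).elim) (fun _ => 1) fun _ a ha => by
      obtain ⟨⟨k, e⟩, hke, rfl⟩ := Finset.mem_image.1 ha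
      simp only [Finset.mem_product, Finset.mem_range] at hke
      have := aeval_conjugate_eq_zero hmem k hke.2
      rw [coeffPoly_coeff hp] at this
      rwa [pow_one, dvd_iff_isRoot, IsRoot, eval_map_algebraMap]
  rw [natDegree_map] at hc
  simp only [Finset.univ_unique, Finset.sum_singleton, hα, mul_one] at hc
  exact absurd ((natDegree_lt_iff_degree_lt hp0).2 hp) (not_lt.2 hc)

theorem finrank_quotient_multiplicitySubspace {F K : Type*} [Field F] [Fintype F] [Field K]
    [DecidableEq K] [Algebra F K] {r t m : ℕ} (hr : 0 < r) (hK : Module.finrank F K = r)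
    (hrt : r * t ≤ m) {ω : Fˣ} {α : K} (hα : (foldedOrbit r 1 ω α).card = r * 1) :
    Module.finrank F ((Fin m → F) ⧸ multiplicitySubspace (F := F) m t α) = r * t := by
  let φ : F[X] →ₗ[F] (Fin t → K) := LinearMap.pi fun i =>
    ((lcoeff K (i : ℕ) ∘ₗ taylor α : K[X] →ₗ[K] K).restrictScalars F) ∘ₗ
      (mapAlgHom (Algebra.ofId F K) : F[X] →ₐ[F] K[X]).toLinearMap
  have hker : ∀ n, multiplicitySubspace n t α = LinearMap.ker (φ ∘ₗ coeffPolyHom F n) := by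
    intro n
    ext v
    rw [LinearMap.mem_ker, funext_iff]
    change (X - C α) ^ t ∣ (coeffPoly v).map (algebraMap F K) ↔ _
    -- Multiplicity is read off Taylor coefficients, not derivatives, so no condition on the
    -- characteristic enters here.
    rw [X_sub_C_pow_dvd_iff, X_pow_dvd_iff, ← taylor_apply]
    exact ⟨fun h i => h i i.2, fun h i hi => h ⟨i, hi⟩⟩
  rw [hker]
  refine finrank_quotient_ker_comp_coeffPolyHom hr hK hrt φ fun p hp h => ?_
  by_contra hp0
  have hmem : (fun j : Fin (r * t) => p.coeff j) ∈ multiplicitySubspace (r * t) t α := by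
    rw [hker, LinearMap.mem_ker, LinearMap.comp_apply, coeffPolyHom_apply, coeffPoly_coeff hp, h]
  have hne : p.map (algebraMap F K) ≠ 0 := Polynomial.map_ne_zero hp0
  have hc := sum_mul_card_le_natDegree hne (fun _ : Unit => foldedOrbit r 1 ω α)
    (fun i j hij => (hij rfl).elim) (fun _ => t) fun _ a ha => by
      obtain ⟨⟨k, e⟩, hke, rfl⟩ := Finset.mem_image.1 ha
      simp only [Finset.mem_product, Finset.mem_range, Nat.lt_one_iff] at hke
      have := X_sub_C_conjugate_pow_dvd hmem k
      rw [coeffPoly_coeff hp] at this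
      rwa [hke.2, pow_zero, mul_one]
  rw [natDegree_map] at hc
  simp only [Finset.univ_unique, Finset.sum_singleton, hα, mul_one] at hc
  exact absurd ((natDegree_lt_iff_degree_lt hp0).2 hp) (not_lt.2 hc)

/-! ### The number of centres kept -/

/-- This is the maximality of the greedy choice: an element with a full orbit is either kept, and
then meets its own nonempty orbit, or was rejected because of an intersection. -/
theorem exists_mem_greedyCentres_not_disjoint {F K : Type*} [Field F] [Fintype F] [Field K]
    [DecidableEq K] [Algebra F K] {r t : ℕ} (hr : 0 < r) (ht : 0 < t) (ω : Fˣ) {α : K}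
    (hα : (foldedOrbit r t ω α).card = r * t) {l : List K} (hl : α ∈ l) :
    ∃ β ∈ greedyCentres r t ω l, ¬ Disjoint (foldedOrbit r t ω α) (foldedOrbit r t ω β) := by
  induction l with
  | nil => simp at hl
  | cons a l ih =>
    rw [greedyCentres]
    rcases List.mem_cons.1 hl with rfl | hl
    · split_ifs with h
      · refine ⟨α, by simp, ?_⟩
        rw [disjoint_self, Finset.bot_eq_empty, ← Finset.card_eq_zero, hα]
        positivity
      · simpa [hα] using h
    · obtain ⟨β, hβ, h⟩ := ih hl
      split_ifs with hif
      · exact ⟨β, List.mem_cons_of_mem _ hβ, h⟩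
      · exact ⟨β, hβ, h⟩

theorem pow_card_pow_mod {F K : Type*} [Field F] [Fintype F] [Field K] [Algebra F K] [Fintype K]
    {r : ℕ} (hcard : Fintype.card K = Fintype.card F ^ r) (x : K) (k : ℕ) :
    x ^ (Fintype.card F ^ (k % r)) = x ^ (Fintype.card F ^ k) := by
  conv_rhs => rw [← Nat.mod_add_div k r, pow_add, pow_mul, pow_mul (Fintype.card F), ← hcard,
    FiniteField.pow_card_pow]

theorem card_filter_foldedOrbit_le {F K : Type*} [Field F] [Fintype F] [Field K] [DecidableEq K]
    [Algebra F K] [Fintype K] {r t : ℕ} (hr : 0 < r) (ht : 0 < t)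
    (hcard : Fintype.card K = Fintype.card F ^ r) (ω : Fˣ) (l : List K) (hl : ∀ x : K, x ∈ l) :
    (Finset.univ.filter fun α : K => (foldedOrbit r t ω α).card = r * t).card ≤
      (greedyCentres r t ω l).length * (r * (2 * t)) := by
  set q := Fintype.card F with hq
  set w : K := algebraMap F K ω with hw
  have hw0 : w ≠ 0 := by simp [hw]
  have hwq : ∀ k e : ℕ, (w ^ e) ^ (q ^ k) = w ^ e := fun k e => by
    rw [hw, ← map_pow, algebraMap_pow_card_pow]
  -- If the orbits of α and β meet, then α is a conjugate of β times ω^(j-i). The offset t keeps the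
  -- exponent j-i+t a natural number below 2t.
  let B : K → Finset K := fun β => (Finset.range r ×ˢ Finset.range (2 * t)).image
    fun p => β ^ (q ^ p.1) * w ^ p.2 * (w ^ t)⁻¹
  have hsub : (Finset.univ.filter fun α : K => (foldedOrbit r t ω α).card = r * t) ⊆
      (greedyCentres r t ω l).toFinset.biUnion B := by
    intro α hα
    obtain ⟨β, hβ, h⟩ := exists_mem_greedyCentres_not_disjoint hr ht ω
      (Finset.mem_filter.1 hα).2 (hl α)
    obtain ⟨x, hxα, hxβ⟩ := Finset.not_disjoint_iff.1 h
    obtain ⟨⟨a, i⟩, hai, rfl⟩ := Finset.mem_image.1 hxα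
    obtain ⟨⟨b, j⟩, hbj, hab⟩ := Finset.mem_image.1 hxβ
    simp only [Finset.mem_product, Finset.mem_range, ← hq, ← hw] at hai hbj hab
    have h1 : α * w ^ i = β ^ (q ^ ((b + (r - a)) % r)) * w ^ j := by
      -- Raising to the power q^(r-a) completes q^a to q^r, which acts trivially on K.
      have := congrArg (fun y => y ^ (q ^ (r - a))) hab
      simp only [mul_pow, hwq, ← pow_mul, ← pow_add] at this
      rw [Nat.add_sub_cancel' hai.1.le, ← pow_card_pow_mod hcard β, ← pow_card_pow_mod hcard α,
        Nat.mod_self, pow_zero, pow_one] at this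
      exact this.symm
    rw [Finset.mem_biUnion]
    refine ⟨β, List.mem_toFinset.2 hβ, Finset.mem_image.2
      ⟨((b + (r - a)) % r, j + (t - i)), ?_, ?_⟩⟩
    · simp only [Finset.mem_product, Finset.mem_range]
      exact ⟨Nat.mod_lt _ hr, by omega⟩
    · rw [pow_add, ← mul_assoc, ← h1, mul_assoc α, ← pow_add, Nat.add_sub_cancel' hai.2.le,
        mul_assoc, mul_inv_cancel₀ (pow_ne_zero _ hw0), mul_one]
  calc _ ≤ ((greedyCentres r t ω l).toFinset.biUnion B).card := Finset.card_le_card hsub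
    _ ≤ (greedyCentres r t ω l).toFinset.card * (r * (2 * t)) :=
        Finset.card_biUnion_le_card_mul _ _ _ fun β _ => Finset.card_image_le.trans (by simp)
    _ ≤ _ := Nat.mul_le_mul_right _ (List.toFinset_card_le _)

/-- An element with a small orbit is zero or a root of unity of small order. -/
theorem exists_pow_eq_one_of_card_foldedOrbit_ne {F K : Type*} [Field F] [Fintype F] [Field K]
    [DecidableEq K] [Algebra F K] [Fintype K] {r t : ℕ} (ht : t < Fintype.card F)
    (hcard : Fintype.card K = Fintype.card F ^ r) {ω : Fˣ}
    (hω : ∀ x : Fˣ, x ∈ Subgroup.zpowers ω) {α : K} (h0 : α ≠ 0)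
    (hα : (foldedOrbit r t ω α).card ≠ r * t) :
    ∃ k, 0 < k ∧ k ≤ r / 2 ∧ α ^ ((Fintype.card F ^ k - 1) * (r / k)) = 1 := by
  set q := Fintype.card F with hq
  have hq0 : 0 < q := Fintype.card_pos
  have hlam : ∀ (c : F) (k : ℕ), (algebraMap F K c) ^ (q ^ k) = algebraMap F K c :=
    fun c k => algebraMap_pow_card_pow k c
  -- A collision between different Frobenius exponents, after a Frobenius power is undone, makes a
  -- conjugate of α an F-multiple of α. With equal exponents it would force equal powers of ω.
  have hex : ∃ k, 0 < k ∧ k < r ∧ ∃ c : F, α ^ (q ^ k) = algebraMap F K c * α := by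
    have key : ∀ a b i j : ℕ, a < b → b < r →
        α ^ (q ^ a) * algebraMap F K ω ^ i = α ^ (q ^ b) * algebraMap F K ω ^ j →
        ∃ k, 0 < k ∧ k < r ∧ ∃ c : F, α ^ (q ^ k) = algebraMap F K c * α := by
      intro a b i j hab hb h
      refine ⟨b - a, by omega, by omega, (ω : F) ^ i * ((ω : F) ^ j)⁻¹, ?_⟩
      have hinj : Function.Injective (FiniteField.frobeniusAlgHom F K ^ a : K →ₐ[F] K) :=
        RingHom.injective _
      apply hinj
      rw [frobeniusAlgHom_pow_apply, frobeniusAlgHom_pow_apply, mul_pow, ← hq, hlam, ← pow_mul,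
        ← pow_add, Nat.sub_add_cancel hab.le, map_mul, map_pow, map_inv₀, map_pow, mul_right_comm,
        mul_comm _ (α ^ _), h, mul_assoc, mul_inv_cancel₀ (by simp), mul_one]
    have hninj : ¬ Set.InjOn
        (fun p : ℕ × ℕ => α ^ (Fintype.card F ^ p.1) * algebraMap F K ω ^ p.2)
        (Finset.range r ×ˢ Finset.range t : Finset (ℕ × ℕ)) := fun h =>
      hα (by rw [foldedOrbit, Finset.card_image_of_injOn h]; simp)
    simp only [Set.InjOn, not_forall] at hninj
    obtain ⟨⟨a, i⟩, hai, ⟨b, j⟩, hbj, h, hne⟩ := hninj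
    simp only [Finset.coe_product, Set.mem_prod, Finset.mem_coe, Finset.mem_range] at hai hbj
    rcases lt_trichotomy a b with hab | rfl | hab
    · exact key a b i j hab hbj.1 h
    · exfalso
      apply hne
      have := mul_left_cancel₀ (pow_ne_zero _ h0) h
      simp only [← map_pow] at this
      rw [injOn_pow_of_generator hω (by omega) (by omega) ((algebraMap F K).injective this)]
    · exact key b a j i hab hai.1 h.symm
  classical
  -- The least such k divides r, since otherwise r % k would also qualify. Iterating r/k times then
  -- gives c^(r/k) = 1, where c = α^(q^k - 1).
  have hex' : ∃ k, 0 < k ∧ ∃ c : F, α ^ (q ^ k) = algebraMap F K c * α :=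
    hex.imp fun k hk => ⟨hk.1, hk.2.2⟩
  obtain ⟨hk, c, hc⟩ := Nat.find_spec hex'
  have hmin := fun n => Nat.find_min hex' (m := n)
  have hkr : Nat.find hex' < r := by
    obtain ⟨k, h1, h2, h3⟩ := hex
    exact (Nat.find_min' hex' ⟨h1, h3⟩).trans_lt h2
  generalize Nat.find hex' = k at hk hc hmin hkr
  have hc0 : algebraMap F K c ≠ 0 := by
    intro h
    rw [h, zero_mul] at hc
    exact h0 (pow_eq_zero_iff (pow_pos hq0 k).ne' |>.1 hc)
  have hiter : ∀ n, α ^ (q ^ (k * n)) = algebraMap F K c ^ n * α := by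
    intro n
    induction n with
    | zero => simp
    | succ n ih =>
      rw [mul_add, mul_one, pow_add, pow_mul, ih, mul_pow, ← map_pow, hlam, hc, map_pow, pow_succ,
        mul_assoc]
  have hr : algebraMap F K c ^ (r / k) * α ^ (q ^ (r % k)) = α := by
    have h1 : α ^ (q ^ r) = α := by rw [← hcard, FiniteField.pow_card]
    have h2 : α ^ (q ^ r) = (α ^ (q ^ (k * (r / k)))) ^ (q ^ (r % k)) := by
      rw [← pow_mul, ← pow_add, Nat.div_add_mod]
    rw [h1, hiter, mul_pow, ← map_pow, hlam] at h2
    rw [← map_pow]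
    exact h2.symm
  have hmod : r % k = 0 := by
    by_contra hne
    refine hmin (r % k) (Nat.mod_lt _ hk) ⟨Nat.pos_of_ne_zero hne, (c ^ (r / k))⁻¹, ?_⟩
    rw [map_inv₀, map_pow, eq_inv_mul_iff_mul_eq₀ (pow_ne_zero _ hc0), hr]
  refine ⟨k, hk, ?_, ?_⟩
  · obtain ⟨n, hn⟩ := Nat.dvd_of_mod_eq_zero hmod
    have hn2 : 2 ≤ n := by
      by_contra hlt
      have : n ≤ 1 := by omega
      have := Nat.mul_le_mul_left k this
      omega
    have := Nat.mul_le_mul_left k hn2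
    omega
  · have h1 : α ^ (q ^ k - 1) = algebraMap F K c := by
      apply mul_right_cancel₀ h0
      rw [← pow_succ, Nat.sub_add_cancel (Nat.one_le_pow _ _ hq0), hc]
    rw [hmod, pow_zero, pow_one] at hr
    rw [pow_mul, h1]
    exact mul_right_cancel₀ h0 (hr.trans (one_mul α).symm)

theorem three_mul_sum_bound {q r : ℕ} (hr : 0 < r) (hrq : r < q) :
    3 * (1 + ∑ k ∈ Finset.Icc 1 (r / 2), (q ^ k - 1) * (r / k)) ≤ 2 * q ^ r := by
  -- Since r/k ≤ r ≤ q-1, the k-th term is at most q^k(q-1), and the sum telescopes.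
  have hgeo : ∀ h, 1 + ∑ k ∈ Finset.Icc 1 h, (q ^ k - 1) * (r / k) ≤ q ^ (h + 1) := by
    intro h
    induction h with
    | zero => simp; omega
    | succ h ih =>
      rw [Finset.sum_Icc_succ_top (by omega), ← add_assoc]
      calc _ ≤ q ^ (h + 1) + q ^ (h + 1) * (q - 1) :=
            Nat.add_le_add ih (Nat.mul_le_mul (Nat.sub_le _ _)
              ((Nat.div_le_self _ _).trans (by omega)))
        _ = q ^ (h + 1 + 1) := by
            rw [pow_succ _ (h + 1), add_comm, ← Nat.mul_succ]
            congr 1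
            omega
  -- For r ≥ 3 the exponent r/2+1 is at most r-1 and q ≥ 3 suffices. For r = 2 the telescoped bound
  -- q^2 is too weak, so small r is computed directly.
  rcases Nat.lt_or_ge r 3 with h3 | h3
  · interval_cases r
    · simp
      omega
    · simp only [Nat.reduceDiv, Finset.Icc_self, Finset.sum_singleton, pow_one, Nat.div_one]
      obtain ⟨p, rfl⟩ := Nat.exists_eq_add_of_lt hrq
      have : 2 + p + 1 - 1 = p + 2 := by omega
      rw [this]
      nlinarith
  · have h1 := hgeo (r / 2)
    have h2 : q ^ (r / 2 + 1) ≤ q ^ (r - 1) := Nat.pow_le_pow_right (by omega) (by omega)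
    have h4 : q ^ r = q ^ (r - 1) * q := by rw [← pow_succ]; congr 1; omega
    have h5 : q ^ (r - 1) * 3 ≤ q ^ (r - 1) * q := Nat.mul_le_mul_left _ (by omega)
    omega

theorem card_pow_le_three_mul_card_filter {F K : Type*} [Field F] [Fintype F] [Field K]
    [DecidableEq K] [Algebra F K] [Fintype K] {r t : ℕ} (hr : 0 < r) (hrq : r < Fintype.card F)
    (ht : t < Fintype.card F) (hcard : Fintype.card K = Fintype.card F ^ r) {ω : Fˣ}
    (hω : ∀ x : Fˣ, x ∈ Subgroup.zpowers ω) :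
    Fintype.card F ^ r ≤
      3 * (Finset.univ.filter fun α : K => (foldedOrbit r t ω α).card = r * t).card := by
  set q := Fintype.card F with hq
  have hsub : (Finset.univ.filter fun α : K => ¬ (foldedOrbit r t ω α).card = r * t) ⊆
      insert 0 ((Finset.Icc 1 (r / 2)).biUnion fun k =>
        (nthRoots ((q ^ k - 1) * (r / k)) (1 : K)).toFinset) := by
    intro α hα
    rw [Finset.mem_insert]
    by_cases h0 : α = 0
    · exact Or.inl h0
    · right
      obtain ⟨k, hk, hkr, h⟩ :=
        exists_pow_eq_one_of_card_foldedOrbit_ne ht hcard hω h0 (Finset.mem_filter.1 hα).2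
      rw [Finset.mem_biUnion]
      refine ⟨k, Finset.mem_Icc.2 ⟨hk, hkr⟩, ?_⟩
      rw [Multiset.mem_toFinset, mem_nthRoots]
      · exact h
      · have h1 : q ^ 1 ≤ q ^ k := Nat.pow_le_pow_right Fintype.card_pos hk
        have h2 : 0 < r / k := Nat.div_pos (by omega) hk
        have h3 : 1 < q := Fintype.one_lt_card
        exact Nat.mul_pos (by rw [pow_one] at h1; omega) h2
  have hbad : (Finset.univ.filter fun α : K => ¬ (foldedOrbit r t ω α).card = r * t).card ≤
      1 + ∑ k ∈ Finset.Icc 1 (r / 2), (q ^ k - 1) * (r / k) := by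
    refine (Finset.card_le_card hsub).trans ((Finset.card_insert_le _ _).trans ?_)
    rw [add_comm]
    refine Nat.add_le_add_left (Finset.card_biUnion_le.trans (Finset.sum_le_sum fun k _ => ?_)) _
    exact (Multiset.toFinset_card_le _).trans (card_nthRoots _ _)
  have hsum := Finset.card_filter_add_card_filter_not (s := (Finset.univ : Finset K))
    (fun α : K => (foldedOrbit r t ω α).card = r * t)
  rw [Finset.card_univ, hcard] at hsum
  have := three_mul_sum_bound hr hrq
  omega

/-- The constant 1/6 combines the third of the field having full orbits with the factor 2 in the 2rt
relations to a kept centre. -/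
theorem le_length_greedyCentres {F K : Type*} [Field F] [Fintype F] [Field K]
    [DecidableEq K] [Algebra F K] {r t : ℕ} (hr : 0 < r) (ht : 0 < t) (hrq : r < Fintype.card F)
    (htq : t < Fintype.card F) (hK : Module.finrank F K = r) {ω : Fˣ}
    (hω : ∀ x : Fˣ, x ∈ Subgroup.zpowers ω) (l : List K) (hl : ∀ x : K, x ∈ l) :
    (1 / 6 : ℝ) * ((Fintype.card F : ℝ) ^ r / ((r : ℝ) * t)) ≤
      ((greedyCentres r t ω l).length : ℝ) := by
  have : FiniteDimensional F K := Module.finite_of_finrank_pos (by omega)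
  have : Finite K := Module.finite_of_finite F
  have := Fintype.ofFinite K
  have hcard : Fintype.card K = Fintype.card F ^ r := by
    rw [Module.card_eq_pow_finrank (K := F), hK]
  have h1 := card_pow_le_three_mul_card_filter (K := K) hr hrq htq hcard hω
  have h2 := card_filter_foldedOrbit_le hr ht hcard ω l hl
  have h3 : Fintype.card F ^ r ≤ 6 * ((greedyCentres r t ω l).length * (r * t)) := by linarith
  have h4 : (Fintype.card F : ℝ) ^ r ≤ 6 * ((greedyCentres r t ω l).length * ((r : ℝ) * t)) := by
    exact_mod_cast h3
  have hpos : (0 : ℝ) < (r : ℝ) * t := mul_pos (Nat.cast_pos.2 hr) (Nat.cast_pos.2 ht)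
  rw [mul_div_assoc', div_le_iff₀ hpos]
  linarith

/-! ### The main theorem -/

theorem mainTheorem6 :
    ∃ c : ℝ, 0 < c ∧
      ∀ (F : Type*) [Field F] [Fintype F] (s r t m : ℕ),
        0 < s → 0 < r → s ≤ t → t ≤ m → m < Fintype.card F → r * t ≤ m →
        ∀ (K : Type*) [Field K] [DecidableEq K] [Algebra F K], Module.finrank F K = r →
        ∀ ω : Fˣ, (∀ x : Fˣ, x ∈ Subgroup.zpowers ω) →
        ∀ l : List K, (∀ x : K, x ∈ l) →
          (c * ((Fintype.card F : ℝ) ^ r / ((r : ℝ) * t)) ≤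
              ((greedyCentres r t ω l).length : ℝ) ∧
            (∀ i, Module.finrank F ((Fin m → F) ⧸ foldedDesign r t m ω l i) = r * t) ∧
            IsStrongSubspaceDesign (foldedDesign r t m ω l) s
              (((m : ℝ) - 1 - ((s : ℝ) - 1) / 2) * s / ((r : ℝ) * ((t : ℝ) - s + 1)))) ∧
          (m < ringChar F →
            c * ((Fintype.card F : ℝ) ^ r / ((r : ℝ) * t)) ≤
              ((greedyCentres r 1 ω l).length : ℝ) ∧
            (∀ i, Module.finrank F ((Fin m → F) ⧸ multiplicityDesign r t m ω l i) = r * t) ∧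
            IsStrongSubspaceDesign (multiplicityDesign r t m ω l) s
              (((m : ℝ) - s) * s / ((r : ℝ) * ((t : ℝ) - s + 1)))) := by
  refine ⟨1 / 6, by norm_num, ?_⟩
  intro F _ _ s r t m hs hr hst htm hmq hrt K _ _ _ hK ω hω l hl
  have ht : 0 < t := hs.trans_le hst
  have hrq : r < Fintype.card F := (Nat.le_mul_of_pos_right r ht).trans_lt (hrt.trans_lt hmq)
  refine ⟨⟨le_length_greedyCentres hr ht hrq (htm.trans_lt hmq) hK hω l hl, fun i => ?_,
    isStrongSubspaceDesign_foldedDesign hs hr hst hmq hK hω l⟩, fun hchar => ⟨?_, fun i => ?_,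
    isStrongSubspaceDesign_multiplicityDesign hr hst hchar hK ω l⟩⟩
  · exact finrank_quotient_foldedSubspace hr hK hrt
      ((greedyCentres_spec hr ht hK ω l).1 _ (List.get_mem _ i)).2
  -- The centres here come from orbits with parameter 1, so the count is at least q^r/(6r), stronger
  -- than required.
  · refine le_trans ?_ (le_length_greedyCentres hr one_pos hrq Fintype.one_lt_card hK hω l hl)
    have h1 : (1 : ℝ) ≤ t := by exact_mod_cast ht
    have h2 : (0 : ℝ) < r := by exact_mod_cast hr
    rw [Nat.cast_one]
    gcongr
  · exact finrank_quotient_multiplicitySubspace hr hK hrt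
      ((greedyCentres_spec hr one_pos hK ω l).1 _ (List.get_mem _ i)).2
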